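/- **Theorem ($\Lambda_n$ versus $\Omega_n$).** *Definitions.* The Lucas cube $\Lambda_n$ is the graph whose vertices are the binary strings $u_1\cdots u_n$ in which no two cyclically consecutive entries are both $1$ (that is, there is no $i$ with $u_i=u_{i+1}=1$, indices modulo $n$), two strings being adjacent when they differ in exactly one position. A *lucasene* with $n$ hexagons is a chain $h_1,\dots,h_n$ of distinct hexagons of the regular hexagonal tiling of the plane, two of which share an edge exactly when they are consecutive, in which $h_1,h_2,h_3$ are linearly attached (if $n\ge 3$) and no other three consecutive hexagons are. Colour the vertices of the tiling properly black and white; the *directed inner dual graph* has an arc from $h_i$ to $h_j$ if they share an edge whose white end lies on the right when it is crossed from $h_i$ to $h_j$. An *$L$-fence* $\Xi_n$ is a poset whose Hasse diagram (with arcs from an element to the elements that it covers) is isomorphic to the directed inner dual graph of a lucasene with $n$ hexagons; explicitly, up to duality, it is $\{x_1,\dots,x_n\}$ with the covering relations $x_1>x_2>x_3<x_4>x_5<\cdots$. Let $\Omega_n$ be the finite distributive lattice of all filters (up-sets, including $\emptyset$) of $\Xi_n$ ordered by reverse inclusion; its undirected Hasse diagram is also denoted by $\Omega_n$. *Statement.*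 Let $n\ge 2$ and let $\Xi_n$ be any $L$-fence with $n$ elements. 1. For every $k\ge 0$, the graphs $\Lambda_n$ and $\Omega_n$ have the same number of induced subgraphs isomorphic to the $k$-dimensional hypercube. 2. If $n\ge 3$, then the graphs $\Lambda_n$ and $\Omega_n$ are not isomorphic. 3. If $n=2m$ with $m\ge 1$, then $\Lambda_{2m}$ can be oriented as the Hasse diagram of a finite distributive lattice $L$; if $m\ge 2$, then such an $L$ is not isomorphic to the lattice $\Omega_{2m}$. 4. If $n=2m+1$ with $m\ge 1$, then $\Lambda_{2m+1}$ is not isomorphic to the undirected Hasse diagram of any finite distributive lattice. -/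

import Mathlib

/-- The `k`-dimensional hypercube: binary strings of length `k`, adjacent when they differ in
exactly one position. -/
def hypercube (k : ℕ) : SimpleGraph (Fin k → Bool) where
  Adj u v := hammingDist u v = 1
  symm := ⟨fun u v h => by rw [hammingDist_comm]; exact h⟩
  loopless := ⟨fun u h => by simp at h⟩

/-- Lucas strings of length `n`: binary strings without two cyclically consecutive ones. -/
def IsLucasString {n : ℕ} (u : Fin n → Bool) : Prop :=
  ∀ i j : Fin n, (j : ℕ) = ((i : ℕ) + 1) % n → ¬ (u i = true ∧ u j = true)

/-- The Lucas cube `Λ_n`: the subgraph of the `n`-cube induced by the Lucas strings. -/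
def lucasCube (n : ℕ) : SimpleGraph {u : Fin n → Bool // IsLucasString u} :=
  (hypercube n).induce {u | IsLucasString u}

/-- The number of `k`-dimensional induced hypercubes of `G`: the number of vertex sets whose
induced subgraph is isomorphic to the `k`-cube. -/
noncomputable def inducedCubeCount {V : Type*} (G : SimpleGraph V) (k : ℕ) : ℕ :=
  {S : Set V | Nonempty (G.induce S ≃g hypercube k)}.ncard

/-- The cells of the regular hexagonal tiling of the plane, in axial coordinates: `(a, b)` is the
hexagon with centre `a • e + b • e'`, where `e, e'` have equal length and `e'` is `e` rotated by
60 degrees counterclockwise. -/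
abbrev HexCell : Type := ℤ × ℤ

/-- There is an arc from `c` to `d` in the directed inner dual: the hexagons `c` and `d` share an
edge, and when this edge is crossed from `c` to `d` its white end lies on the right.
Each vertex of the tiling is the common corner of three hexagons, it is black if these are
`p, p + (1, 0), p + (0, 1)` and white if they are `p, p - (1, 0), p - (0, 1)`, for some `p`;
this is a proper 2-colouring. -/
def HexArc (c d : HexCell) : Prop :=
  d - c = (1, 0) ∨ d - c = (-1, 1) ∨ d - c = (0, -1)

/-- Two hexagons share an edge. -/
def HexAdj (c d : HexCell) : Prop := HexArc c d ∨ HexArc d c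

/-- `h 0, …, h (n-1)` are the successive hexagons of a hexagonal chain: they are distinct, and two
of them share an edge exactly when they are consecutive. -/
structure IsHexChain {n : ℕ} (h : Fin n → HexCell) : Prop where
  injective : Function.Injective h
  adj_iff : ∀ i j : Fin n, HexAdj (h i) (h j) ↔ ((i : ℕ) + 1 = j ∨ (j : ℕ) + 1 = i)

/-- Lucasenes: hexagonal chains in which the first three hexagons are linearly attached and no
other three consecutive hexagons are. (Any chain with at most two hexagons qualifies.) -/
structure IsLucasene {n : ℕ} (h : Fin n → HexCell) : Prop extends IsHexChain h where
  linear_iff : ∀ i j k : Fin n, (i : ℕ) + 1 = j → (j : ℕ) + 1 = k →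
    (h k - h j = h j - h i ↔ (i : ℕ) = 0)

/-- `Ξ` is an `L`-fence `Ξ_n`: its Hasse diagram, with arcs going from an element to the elements
it covers, is isomorphic to the directed inner dual graph of a lucasene with `n` hexagons. -/
def IsLFence (n : ℕ) (Ξ : Type*) [PartialOrder Ξ] : Prop :=
  ∃ h : Fin n → HexCell, IsLucasene h ∧
    ∃ e : Fin n ≃ Ξ, ∀ i j : Fin n, e j ⋖ e i ↔ HexArc (h i) (h j)

/-- The matchable Lucas distributive lattice `Ω_n` of an `L`-fence `Ξ = Ξ_n`: all filters (up-sets,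
including the empty one) of `Ξ`, ordered by reverse inclusion. -/
abbrev MatchableLucasLattice (Ξ : Type*) [PartialOrder Ξ] : Type _ := UpperSet Ξ

/-! Both graphs embed in a cube of finite sets: Λ_n as the independent sets of an n-cycle, Ω_n as
the upper sets of Ξ_n. Every cube inside a cube graph is an interval, fixed by its top T and its
direction set S (`exists_eq_subcubeEmbedding`, `inducedCubeCount_eq_ncard`). For Λ_n the pairs (T,
S) that occur are those with T independent and S ⊆ T. For Ω_n, S consists of minimal elements of T;
replacing T by its minimal elements gives pairs S ⊆ A with A an antichain. By
`IsLucasene.lt_or_gt_iff`, antichains are the independent sets of the path 0, 1, ..., n-1 with the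
extra edge 0–2. A bijection between the two kinds of independent sets
(`ncard_cyclicIndep_eq_ncard_fenceIndep`) equates the counts.

The graphs differ for n ≥ 3 because the zero string has n neighbours, while no upper set of an
n-element poset with a three-element chain allows every element to be toggled.

For even n, complementing at the odd positions turns independent sets of the cycle into upper sets
of a crown. For odd n, Birkhoff's theorem makes any candidate lattice a lattice of upper sets, in
whose Hasse diagram every vertex lies on a geodesic from top to bottom. Two such vertices of Λ_n
would be complementary strings, both without cyclically consecutive ones, so they would alternate
around an odd cycle. -/

open scoped symmDiff

/-- The cube graph on the finite subsets of `α`: two sets are adjacent when they differ in exactly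
one element. -/
def cubeGraph (α : Type*) [DecidableEq α] : SimpleGraph (Finset α) where
  Adj s t := (s ∆ t).card = 1
  symm := ⟨fun s t h => by rw [symmDiff_comm]; exact h⟩
  loopless := ⟨fun s h => by simp at h⟩

/-! ### Cubes inside cube graphs, and how to count them -/

section Cube

variable {α β : Type*} [DecidableEq α] [DecidableEq β]

@[simp] theorem Finset.symmDiff_empty (s : Finset α) : s ∆ ∅ = s := symmDiff_bot s

@[simp] theorem Finset.empty_symmDiff (s : Finset α) : ∅ ∆ s = s := bot_symmDiff s

theorem cubeGraph_adj {s t : Finset α} : (cubeGraph α).Adj s t ↔ (s ∆ t).card = 1 := Iff.rfl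

theorem cubeGraph_adj_iff_exists {s t : Finset α} :
    (cubeGraph α).Adj s t ↔ ∃ a, t = s ∆ {a} := by
  rw [cubeGraph_adj, Finset.card_eq_one]
  refine exists_congr fun a => ⟨fun h => ?_, fun h => ?_⟩
  · rw [← h, symmDiff_symmDiff_cancel_left]
  · rw [h, symmDiff_symmDiff_cancel_left]

/-- The binary string `x` as the set of its positions carrying a one. -/
def onesEquiv (ι : Type*) [Fintype ι] [DecidableEq ι] : (ι → Bool) ≃ Finset ι where
  toFun x := Finset.univ.filter fun i => x i = true
  invFun s i := decide (i ∈ s)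
  left_inv x := by ext i; simp
  right_inv s := by ext i; simp

@[simp] theorem mem_onesEquiv {ι : Type*} [Fintype ι] [DecidableEq ι] {x : ι → Bool} {i : ι} :
    i ∈ onesEquiv ι x ↔ x i = true := by simp [onesEquiv]

/-- The hypercube on strings is the cube graph on sets of positions. -/
def hypercubeIso (k : ℕ) : hypercube k ≃g cubeGraph (Fin k) where
  toEquiv := onesEquiv (Fin k)
  map_rel_iff' {x y} := by
    have h : onesEquiv (Fin k) x ∆ onesEquiv (Fin k) y = Finset.univ.filter fun i => x i ≠ y i := by
      ext i
      cases hx : x i <;> cases hy : y i <;> simp [Finset.mem_symmDiff, hx, hy]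
    rw [cubeGraph_adj, h]
    rfl

theorem map_symmDiff_emb (d : α ↪ β) (s t : Finset α) : (s ∆ t).map d = s.map d ∆ t.map d := by
  ext b
  by_cases hb : ∃ a, d a = b
  · obtain ⟨a, rfl⟩ := hb
    simp [Finset.mem_symmDiff]
  · push Not at hb
    simp [Finset.mem_symmDiff, hb]

/-- The subcube through `g` in the directions given by `d`. -/
def subcubeEmbedding (d : α ↪ β) (g : Finset β) : cubeGraph α ↪g cubeGraph β where
  toFun s := g ∆ s.map d
  inj' s t h := by simpa using h
  map_rel_iff' {s t} := by
    have : (g ∆ s.map d) ∆ (g ∆ t.map d) = (s ∆ t).map d := by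
      rw [map_symmDiff_emb, symmDiff_symmDiff_symmDiff_comm]
      simp
    change ((g ∆ s.map d) ∆ (g ∆ t.map d)).card = 1 ↔ _
    rw [this, Finset.card_map, cubeGraph_adj]

/-- Two vertices at distance two have just two common neighbours. For {a} and {b} these are ∅,
excluded by `hp`, and {a, b}. -/
theorem symmDiff_singleton_pair {a b p q : α} (hab : a ≠ b)
    (h : ({a} : Finset α) ∆ {p} = {b} ∆ {q}) (hp : p ≠ a) : p = b := by
  have : a ∈ ({a} : Finset α) ∆ {p} := by simp [Finset.mem_symmDiff, hp.symm]
  rw [h] at this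
  have haq : a = q := by
    simp only [Finset.mem_symmDiff, Finset.mem_singleton] at this; tauto
  subst haq
  have : b ∈ ({b} : Finset α) ∆ {a} := by simp [Finset.mem_symmDiff, hab.symm]
  rw [← h] at this
  simp only [Finset.mem_symmDiff, Finset.mem_singleton] at this
  rcases this with ⟨h1, -⟩ | ⟨h1, -⟩
  · exact absurd h1.symm hab
  · exact h1.symm

/-- Every cube in a cube graph is a subcube. -/
theorem exists_eq_subcubeEmbedding (f : cubeGraph α ↪g cubeGraph β) :
    ∃ (d : α ↪ β) (g : Finset β), ∀ s, f s = g ∆ s.map d := by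
  have h0 : ∀ a, ∃ b, f {a} = f ∅ ∆ {b} := fun a =>
    cubeGraph_adj_iff_exists.1 (f.map_adj_iff.2 (by simp [cubeGraph_adj]))
  choose d hd using h0
  have hinj : Function.Injective d := fun a b hab => by
    have : f {a} = f {b} := by rw [hd, hd, hab]
    simpa using f.injective this
  refine ⟨⟨d, hinj⟩, f ∅, fun s => ?_⟩
  induction s using Finset.strongInduction with
  | H s ih =>
    rcases s.eq_empty_or_nonempty with rfl | ⟨a, ha⟩
    · simp
    by_cases hs : s = {a}
    · subst hs; simpa using hd a
    obtain ⟨b, hb, hba⟩ : ∃ b ∈ s, b ≠ a := by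
      by_contra! hcon
      exact hs (Finset.eq_singleton_iff_unique_mem.2 ⟨ha, hcon⟩)
    -- The square on r, s \ {a}, s \ {b}, s: the images of the first three corners are known by
    -- induction, and the image of s is the common neighbour of the middle two other than f r.
    set r := (s.erase a).erase b with hr
    have ha' : insert a r = s.erase b := by
      ext x; simp only [hr, Finset.mem_insert, Finset.mem_erase]; grind
    have hb' : insert b r = s.erase a := by
      ext x; simp only [hr, Finset.mem_insert, Finset.mem_erase]; grind
    have har : a ∉ r := by simp [hr]
    have hbr : b ∉ r := by simp [hr]
    have hsing : ∀ (t : Finset α) (x : α), x ∉ t → insert x t = t ∆ {x} := by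
      intro t x hx; ext y; simp only [Finset.mem_insert, Finset.mem_symmDiff, Finset.mem_singleton]
      grind
    have hea : s = s.erase a ∆ {a} := by
      rw [← hsing _ _ (by simp), Finset.insert_erase ha]
    have heb : s = s.erase b ∆ {b} := by
      rw [← hsing _ _ (by simp), Finset.insert_erase hb]
    have hrs : r ⊂ s := (Finset.erase_ssubset (by simp [hb, hba])).trans (Finset.erase_ssubset ha)
    have fr := ih r hrs
    have fa : f (s.erase b) = f r ∆ {d a} := by
      rw [ih _ (Finset.erase_ssubset hb), ← ha', hsing _ _ har, map_symmDiff_emb, fr,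
        symmDiff_assoc]
      simp
    have fb : f (s.erase a) = f r ∆ {d b} := by
      rw [ih _ (Finset.erase_ssubset ha), ← hb', hsing _ _ hbr, map_symmDiff_emb, fr,
        symmDiff_assoc]
      simp
    have adj : ∀ x ∈ s, (cubeGraph α).Adj (s.erase x) s := fun x hx => by
      refine cubeGraph_adj_iff_exists.2 ⟨x, ?_⟩
      rw [← hsing _ _ (by simp), Finset.insert_erase hx]
    obtain ⟨p, hp⟩ := cubeGraph_adj_iff_exists.1 (f.map_adj_iff.2 (adj b hb))
    obtain ⟨q, hq⟩ := cubeGraph_adj_iff_exists.1 (f.map_adj_iff.2 (adj a ha))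
    have hpa : p ≠ d a := by
      rintro rfl
      rw [fa, symmDiff_assoc, symmDiff_self, Finset.bot_eq_empty] at hp
      rw [Finset.symmDiff_empty] at hp
      exact hrs.ne (f.injective hp).symm
    have hpb : p = d b := by
      refine symmDiff_singleton_pair (fun h => hba (hinj h).symm) ?_ hpa (q := q)
      rw [fa, symmDiff_assoc] at hp
      rw [fb, symmDiff_assoc, hp] at hq
      simpa using hq
    rw [hp, hpb, ih _ (Finset.erase_ssubset hb)]
    conv_rhs => rw [heb, map_symmDiff_emb, ← symmDiff_assoc]
    simp

theorem symmDiff_subset_iff_between {g r s : Finset α} :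
    g ∆ s ⊆ r ↔ g \ r ⊆ s ∧ s ⊆ g ∪ r := by
  simp only [Finset.subset_iff, Finset.mem_symmDiff, Finset.mem_sdiff, Finset.mem_union]
  grind

variable {V : Type*} {G : SimpleGraph V}

/-- A vertex set of a graph embedded in a cube induces a `k`-cube exactly when it corresponds to
an interval of dimension `k` of the cube. -/
theorem nonempty_induce_iso_hypercube_iff (φ : G ↪g cubeGraph α) {k : ℕ} {W : Set V} :
    Nonempty (G.induce W ≃g hypercube k) ↔
      ∃ T S : Finset α, S ⊆ T ∧ S.card = k ∧ φ '' W = {s | T \ S ⊆ s ∧ s ⊆ T} := by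
  constructor
  · rintro ⟨e⟩
    let ψ : hypercube k ↪g G := (SimpleGraph.Embedding.induce W).comp e.symm.toEmbedding
    obtain ⟨d, g, hdg⟩ := exists_eq_subcubeEmbedding
      ((φ.comp ψ).comp (hypercubeIso k).symm.toEmbedding)
    -- The base point g need not be the top of the subcube; turning on all directions gives the top.
    refine ⟨g ∪ Finset.univ.map d, Finset.univ.map d, Finset.subset_union_right, by simp, ?_⟩
    have hW : φ '' W = Set.range fun s : Finset (Fin k) => g ∆ s.map d := by
      have : (fun s : Finset (Fin k) => g ∆ s.map d) =
          (φ ∘ Subtype.val) ∘ (e.symm ∘ (hypercubeIso k).symm) := by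
        funext s; exact (hdg s).symm
      rw [this, Function.Surjective.range_comp
        (e.symm.surjective.comp (hypercubeIso k).symm.surjective), Set.range_comp]
      simp
    rw [hW]
    ext s
    have hsub : (∃ y : Finset (Fin k), g ∆ y.map d = s) ↔ g ∆ s ⊆ Finset.univ.map d := by
      constructor
      · rintro ⟨y, rfl⟩
        simp
      · intro h
        obtain ⟨u, -, hu⟩ := Finset.subset_map_iff.1 h
        exact ⟨u, by rw [← hu]; simp⟩
    rw [Set.mem_range, hsub, symmDiff_subset_iff_between, Finset.union_sdiff_right]
    rfl
  · rintro ⟨T, S, hST, hk, hW⟩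
    obtain ⟨d, hd⟩ : ∃ d : Fin k ↪ α, Finset.univ.map d = S :=
      ⟨(S.equivFinOfCardEq hk).symm.toEmbedding.trans (Function.Embedding.subtype _), by
        ext a
        simp only [Finset.mem_map, Finset.mem_univ, true_and, Function.Embedding.trans_apply,
          Equiv.coe_toEmbedding, Function.Embedding.subtype_apply]
        exact ⟨fun ⟨b, hb⟩ => hb ▸ ((S.equivFinOfCardEq hk).symm b).2,
          fun h => ⟨S.equivFinOfCardEq hk ⟨a, h⟩, by simp⟩⟩⟩
    have hmem : ∀ s, s ∈ φ '' W ↔ T ∆ s ⊆ S := fun s => by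
      rw [hW, symmDiff_subset_iff_between, Finset.union_eq_left.2 hST]; rfl
    let χ : hypercube k ↪g cubeGraph α :=
      (subcubeEmbedding d T).comp (hypercubeIso k).toEmbedding
    have hχ : ∀ x, χ x ∈ φ '' W := fun x => by
      rw [hmem, ← hd]
      change T ∆ (T ∆ _) ⊆ _
      simp
    choose v hvW hv using hχ
    refine ⟨SimpleGraph.Iso.symm ⟨Equiv.ofBijective (fun x => (⟨v x, hvW x⟩ : W)) ⟨?_, ?_⟩, ?_⟩⟩
    · intro x y h
      have : v x = v y := congrArg Subtype.val h
      exact χ.injective (by rw [← hv, ← hv, this])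
    · rintro ⟨w, hw⟩
      have h := (hmem _).1 (Set.mem_image_of_mem φ hw)
      rw [← hd] at h
      obtain ⟨u, -, hu⟩ := Finset.subset_map_iff.1 h
      refine ⟨(hypercubeIso k).symm u, Subtype.ext (φ.injective ?_)⟩
      change φ (v _) = _
      rw [hv]
      change T ∆ ((hypercubeIso k) ((hypercubeIso k).symm u)).map d = _
      rw [RelIso.apply_symm_apply, ← hu]
      simp
    · intro x y
      change G.Adj (v x) (v y) ↔ _
      rw [← φ.map_adj_iff, hv, hv]
      exact χ.map_adj_iff

/-- Induced `k`-cubes of a graph embedded in a cube are counted by their top vertices and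
directions. -/
theorem inducedCubeCount_eq_ncard (φ : G ↪g cubeGraph α) (k : ℕ) :
    inducedCubeCount G k = {p : Finset α × Finset α | p.2 ⊆ p.1 ∧ p.2.card = k ∧
      ∀ s, p.1 \ p.2 ⊆ s → s ⊆ p.1 → s ∈ Set.range φ}.ncard := by
  have himg : {W : Set V | Nonempty (G.induce W ≃g hypercube k)} =
      (fun p : Finset α × Finset α => φ ⁻¹' {s | p.1 \ p.2 ⊆ s ∧ s ⊆ p.1}) ''
        {p : Finset α × Finset α | p.2 ⊆ p.1 ∧ p.2.card = k ∧
          ∀ s, p.1 \ p.2 ⊆ s → s ⊆ p.1 → s ∈ Set.range φ} := by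
    ext W
    rw [Set.mem_ofPred_eq, nonempty_induce_iso_hypercube_iff φ]
    constructor
    · rintro ⟨T, S, hST, hk, hW⟩
      refine ⟨(T, S), ⟨hST, hk, fun s h1 h2 => ?_⟩, ?_⟩
      · have : s ∈ φ '' W := hW ▸ ⟨h1, h2⟩
        exact Set.image_subset_range _ _ this
      · simp only [← hW]
        exact Set.preimage_image_eq _ φ.injective
    · rintro ⟨⟨T, S⟩, ⟨hST, hk, hr⟩, rfl⟩
      exact ⟨T, S, hST, hk, Set.image_preimage_eq_of_subset fun s hs => hr s hs.1 hs.2⟩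
  rw [inducedCubeCount, himg, Set.InjOn.ncard_image]
  rintro ⟨T, S⟩ ⟨hST, -, hr⟩ ⟨T', S'⟩ ⟨hST', -, hr'⟩ heq
  simp only at hST hr hST' hr' heq
  have hset : {s | T \ S ⊆ s ∧ s ⊆ T} = {s | T' \ S' ⊆ s ∧ s ⊆ T'} := by
    rw [← Set.image_preimage_eq_of_subset (f := φ) (s := {s | T \ S ⊆ s ∧ s ⊆ T})
        fun s hs => hr s hs.1 hs.2, heq,
      Set.image_preimage_eq_of_subset fun s hs => hr' s hs.1 hs.2]
  -- T and T \ S are recovered as the greatest and least elements of the interval.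
  have hT : T = T' := by
    have h1 : T ∈ {s | T' \ S' ⊆ s ∧ s ⊆ T'} := hset ▸ ⟨Finset.sdiff_subset, subset_rfl⟩
    have h2 : T' ∈ {s | T \ S ⊆ s ∧ s ⊆ T} := hset ▸ ⟨Finset.sdiff_subset, subset_rfl⟩
    exact h1.2.antisymm h2.2
  subst hT
  have hd : T \ S = T \ S' := by
    have h1 : T \ S ∈ {s | T \ S' ⊆ s ∧ s ⊆ T} := hset ▸ ⟨subset_rfl, Finset.sdiff_subset⟩
    have h2 : T \ S' ∈ {s | T \ S ⊆ s ∧ s ⊆ T} := hset ▸ ⟨subset_rfl, Finset.sdiff_subset⟩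
    exact h2.1.antisymm h1.1
  have : S = S' := by
    rw [← Finset.sdiff_sdiff_eq_self hST, hd, Finset.sdiff_sdiff_eq_self hST']
  rw [this]

end Cube

/-! ### Lattices of upper sets of a finite poset -/

section UpperSets

variable {P : Type*} [PartialOrder P]

/-- One step from F towards G within upper sets: add a maximal element of G \ F if F ⊆ G, otherwise
remove a minimal element of F \ G. This gives both that covers differ in one element and that the
embedding in the cube is isometric. -/
theorem exists_isUpperSet_symmDiff_singleton [DecidableEq P] {F G : Finset P} (hF : IsUpperSet (F : Set P))
    (hG : IsUpperSet (G : Set P)) (hne : F ≠ G) :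
    ∃ p ∈ F ∆ G, IsUpperSet (↑(F ∆ {p}) : Set P) := by
  by_cases h : F ⊆ G
  · have hn : (G \ F).Nonempty := by
      rw [Finset.sdiff_nonempty]; exact fun h' => hne (h.antisymm h')
    obtain ⟨p, hp⟩ := (G \ F).exists_maximal hn
    have hp1 := Finset.mem_sdiff.1 hp.1
    refine ⟨p, Finset.mem_symmDiff.2 (Or.inr hp1), fun x y hxy hx => ?_⟩
    simp only [Finset.mem_coe, Finset.mem_symmDiff, Finset.mem_singleton] at hx ⊢
    rcases hx with ⟨hx, -⟩ | ⟨rfl, -⟩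
    · have hy : y ∈ F := hF hxy hx
      exact Or.inl ⟨hy, fun h => hp1.2 (h ▸ hy)⟩
    · by_cases hyF : y ∈ F
      · exact Or.inl ⟨hyF, fun h => hp1.2 (h ▸ hyF)⟩
      · have : y ∈ G \ F := Finset.mem_sdiff.2 ⟨hG hxy hp1.1, hyF⟩
        exact Or.inr ⟨(hp.2 this hxy).antisymm hxy, hyF⟩
  · have hn : (F \ G).Nonempty := by rwa [Finset.sdiff_nonempty]
    obtain ⟨p, hp⟩ := (F \ G).exists_minimal hn
    have hp1 := Finset.mem_sdiff.1 hp.1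
    refine ⟨p, Finset.mem_symmDiff.2 (Or.inl hp1), fun x y hxy hx => ?_⟩
    simp only [Finset.mem_coe, Finset.mem_symmDiff, Finset.mem_singleton] at hx ⊢
    rcases hx with ⟨hx, hxp⟩ | ⟨rfl, h⟩
    · refine Or.inl ⟨hF hxy hx, ?_⟩
      rintro rfl
      have : x ∈ F \ G := Finset.mem_sdiff.2 ⟨hx, fun hxG => hp1.2 (hG hxy hxG)⟩
      exact hxp (hxy.antisymm (hp.2 this hxy))
    · exact absurd hp1.1 h

/-- Removing directions `S` from an upper set `T` always leaves upper sets exactly when `S`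
consists of minimal elements of `T`. -/
theorem forall_isUpperSet_between_iff [DecidableEq P] {T S : Finset P} (hST : S ⊆ T) :
    (∀ s, T \ S ⊆ s → s ⊆ T → IsUpperSet (s : Set P)) ↔
      IsUpperSet (T : Set P) ∧ ∀ p ∈ S, Minimal (· ∈ T) p := by
  constructor
  · intro h
    refine ⟨h T Finset.sdiff_subset subset_rfl, fun p hp => ⟨hST hp, fun q hq hqp => ?_⟩⟩
    by_contra hpq
    have hup := h (T.erase p) (fun x hx => by
      rw [Finset.mem_sdiff] at hx
      exact Finset.mem_erase.2 ⟨fun e => hx.2 (e ▸ hp), hx.1⟩) (Finset.erase_subset _ _)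
    have := hup hqp (Finset.mem_coe.2 (Finset.mem_erase.2 ⟨fun e => hpq e.ge, hq⟩))
    simp at this
  · rintro ⟨hT, hmin⟩ s h1 h2 x y hxy hx
    have hyT : y ∈ T := hT hxy (h2 hx)
    by_cases hyS : y ∈ S
    · rw [((hmin y hyS).2 (h2 hx) hxy).antisymm hxy]; exact hx
    · exact h1 (Finset.mem_sdiff.2 ⟨hyT, hyS⟩)

variable [Fintype P]

open Classical in
/-- The elements of an upper set of a finite poset. -/
noncomputable def upperFinset (F : UpperSet P) : Finset P := Finset.univ.filter (· ∈ F)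

@[simp] theorem mem_upperFinset {F : UpperSet P} {p : P} : p ∈ upperFinset F ↔ p ∈ F := by
  simp [upperFinset]

theorem isUpperSet_upperFinset (F : UpperSet P) : IsUpperSet (upperFinset F : Set P) := by
  intro x y hxy hx
  simp only [Finset.mem_coe, mem_upperFinset] at hx ⊢
  exact F.upper hxy hx

theorem upperFinset_injective : Function.Injective (upperFinset (P := P)) := fun F G h => by
  ext p
  simpa using congrArg (p ∈ ·) h

theorem upperFinset_subset {F G : UpperSet P} : upperFinset F ⊆ upperFinset G ↔ G ≤ F := by
  simp [Finset.subset_iff, ← UpperSet.coe_subset_coe, Set.subset_def]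

theorem mem_range_upperFinset {s : Finset P} :
    s ∈ Set.range (upperFinset (P := P)) ↔ IsUpperSet (s : Set P) :=
  ⟨fun ⟨F, hF⟩ => hF ▸ isUpperSet_upperFinset F, fun h => ⟨⟨s, h⟩, by ext; simp⟩⟩

theorem upperFinset_ssubset {F G : UpperSet P} : upperFinset F ⊂ upperFinset G ↔ G < F := by
  rw [ssubset_iff_subset_not_subset, upperFinset_subset, upperFinset_subset, lt_iff_le_not_ge]

variable [DecidableEq P]

theorem card_symmDiff_of_covBy {F G : UpperSet P} (h : F ⋖ G) :
    (upperFinset F ∆ upperFinset G).card = 1 := by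
  obtain ⟨p, hp, hup⟩ := exists_isUpperSet_symmDiff_singleton (isUpperSet_upperFinset F)
    (isUpperSet_upperFinset G) (fun e => h.1.ne (upperFinset_injective e))
  obtain ⟨H, hH⟩ := mem_range_upperFinset.2 hup
  have hGF := (upperFinset_ssubset.2 h.1).1
  have hpF : p ∈ upperFinset F ∧ p ∉ upperFinset G := by
    rcases Finset.mem_symmDiff.1 hp with hp | hp
    · exact hp
    · exact absurd (hGF hp.1) hp.2
  have h1 : F ≤ H := by
    rw [← upperFinset_subset, hH]
    intro x hx
    simp only [Finset.mem_symmDiff, Finset.mem_singleton] at hx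
    rcases hx with hx | hx
    · exact hx.1
    · exact hx.1 ▸ hpF.1
  have h2 : H ≤ G := by
    rw [← upperFinset_subset, hH]
    intro x hx
    exact Finset.mem_symmDiff.2 (Or.inl ⟨hGF hx, by
      rw [Finset.mem_singleton]; rintro rfl; exact hpF.2 hx⟩)
  have hHF : H ≠ F := by
    rintro rfl
    have : p ∈ upperFinset H ∆ {p} := hH ▸ hpF.1
    simp [Finset.mem_symmDiff, mem_upperFinset.1 hpF.1] at this
  have hHG : H = G := by
    by_contra hne
    exact h.2 (lt_of_le_of_ne h1 hHF.symm) (lt_of_le_of_ne h2 hne)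
  rw [← hHG, hH]
  simp

theorem covBy_of_subset_of_card_symmDiff {F G : UpperSet P}
    (hs : upperFinset G ⊆ upperFinset F) (h : (upperFinset F ∆ upperFinset G).card = 1) :
    F ⋖ G := by
  have hc : (upperFinset F).card = (upperFinset G).card + 1 := by
    have : upperFinset F ∆ upperFinset G = upperFinset F \ upperFinset G := by
      rw [symmDiff_def, Finset.sup_eq_union, Finset.sdiff_eq_empty_iff_subset.2 hs,
        Finset.union_empty]
    rw [this] at h
    have := Finset.card_sdiff_add_card_eq_card hs
    omega
  refine ⟨lt_of_le_of_ne (upperFinset_subset.1 hs) ?_, fun H h1 h2 => ?_⟩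
  · rintro rfl; omega
  · have := Finset.card_lt_card (upperFinset_ssubset.2 h1)
    have := Finset.card_lt_card (upperFinset_ssubset.2 h2)
    omega

/-- The Hasse diagram of the lattice of upper sets of `P` as a subgraph of a cube. -/
noncomputable def upperSetEmbedding (P : Type*) [PartialOrder P] [Fintype P] [DecidableEq P] :
    SimpleGraph.hasse (UpperSet P) ↪g cubeGraph P where
  toFun := upperFinset
  inj' := upperFinset_injective
  map_rel_iff' {F G} := by
    change (upperFinset F ∆ upperFinset G).card = 1 ↔ _
    rw [SimpleGraph.hasse_adj]
    constructor
    · intro h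
      obtain ⟨p, hp⟩ := Finset.card_eq_one.1 h
      have hG : upperFinset G = upperFinset F ∆ {p} := by
        rw [← hp, symmDiff_symmDiff_cancel_left]
      by_cases hpF : p ∈ upperFinset F
      · refine Or.inl (covBy_of_subset_of_card_symmDiff ?_ h)
        rw [hG]
        intro x
        simp only [Finset.mem_symmDiff, Finset.mem_singleton]
        rintro (hx | hx)
        · exact hx.1
        · exact hx.1 ▸ hpF
      · rw [symmDiff_comm] at h
        refine Or.inr (covBy_of_subset_of_card_symmDiff ?_ h)
        rw [hG]
        intro x hx
        exact Finset.mem_symmDiff.2 (Or.inl ⟨hx, by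
          rw [Finset.mem_singleton]; rintro rfl; exact hpF hx⟩)
    · rintro (h | h)
      · exact card_symmDiff_of_covBy h
      · rw [symmDiff_comm]; exact card_symmDiff_of_covBy h

-- An upper set of a finite poset is generated by its minimal elements, so tops of cubes correspond
-- to antichains, and the directions form an arbitrary `k`-subset of the antichain.
open Classical in
theorem inducedCubeCount_hasse_upperSet (k : ℕ) :
    inducedCubeCount (SimpleGraph.hasse (UpperSet P)) k =
      {p : Finset P × Finset P | p.2 ⊆ p.1 ∧ p.2.card = k ∧
        IsAntichain (· ≤ ·) (p.1 : Set P)}.ncard := by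
  rw [inducedCubeCount_eq_ncard (upperSetEmbedding P)]
  refine Set.ncard_congr (fun p _ => (p.1.filter (Minimal (· ∈ p.1)), p.2)) ?_ ?_ ?_
  · rintro ⟨T, S⟩ ⟨hST, hk, h⟩
    have h' := (forall_isUpperSet_between_iff hST).1
      fun s h1 h2 => mem_range_upperFinset.1 (h s h1 h2)
    refine ⟨fun p hp => Finset.mem_filter.2 ⟨hST hp, h'.2 p hp⟩, hk, fun a ha b hb hab hle => ?_⟩
    simp only [Finset.coe_filter, Set.mem_ofPred_eq] at ha hb
    exact hab (hle.antisymm (hb.2.2 ha.1 hle))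
  · rintro ⟨T, S⟩ ⟨T', S'⟩ ⟨hST, hk, h⟩ ⟨hST', hk', h'⟩ heq
    have hT : IsUpperSet (T : Set P) := mem_range_upperFinset.1 (h T Finset.sdiff_subset subset_rfl)
    have hT' : IsUpperSet (T' : Set P) :=
      mem_range_upperFinset.1 (h' T' Finset.sdiff_subset subset_rfl)
    simp only [Prod.mk.injEq] at heq ⊢
    have key : ∀ U U' : Finset P, IsUpperSet (U' : Set P) →
        U.filter (Minimal (· ∈ U)) = U'.filter (Minimal (· ∈ U')) → U ⊆ U' := by
      intro U U' hU' e x hx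
      obtain ⟨m, hmx, hm⟩ := U.exists_le_minimal hx
      have : m ∈ U'.filter (Minimal (· ∈ U')) := e ▸ Finset.mem_filter.2 ⟨hm.1, hm⟩
      exact hU' hmx (Finset.mem_filter.1 this).1
    exact ⟨(key T T' hT' heq.1).antisymm (key T' T hT heq.1.symm), heq.2⟩
  · rintro ⟨A, S⟩ ⟨hSA, hk, hA⟩
    -- The upper closure of A; its minimal elements are exactly A because A is an antichain.
    set T : Finset P := Finset.univ.filter fun p => ∃ a ∈ A, a ≤ p with hT
    have hmem : ∀ p, p ∈ T ↔ ∃ a ∈ A, a ≤ p := fun p => by simp [hT]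
    have hAT : A ⊆ T := fun a ha => (hmem a).2 ⟨a, ha, le_rfl⟩
    have hmin : ∀ p, Minimal (· ∈ T) p ↔ p ∈ A := by
      refine fun p => ⟨fun h => ?_, fun h => ⟨hAT h, fun q hq hqp => ?_⟩⟩
      · obtain ⟨a, ha, hap⟩ := (hmem p).1 h.1
        rwa [(h.2 (hAT ha) hap).antisymm hap]
      · obtain ⟨a, ha, haq⟩ := (hmem q).1 hq
        rwa [← hA.eq ha h (haq.trans hqp)]
    have hup : IsUpperSet (T : Set P) := fun x y hxy hx => by
      obtain ⟨a, ha, hax⟩ := (hmem x).1 hx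
      exact (hmem y).2 ⟨a, ha, hax.trans hxy⟩
    have hST : S ⊆ T := hSA.trans hAT
    refine ⟨(T, S), ⟨hST, hk, fun s h1 h2 => mem_range_upperFinset.2 ?_⟩, ?_⟩
    · exact (forall_isUpperSet_between_iff hST).2 ⟨hup, fun p hp => (hmin p).2 (hSA hp)⟩ s h1 h2
    · simp only [hmin, Prod.mk.injEq, and_true]
      ext p
      simp only [Finset.mem_filter]
      exact ⟨fun h => h.2, fun h => ⟨hAT h, h⟩⟩

end UpperSets

/-! ### Graph distance as Hamming distance -/

section Isometry

variable {α : Type*} [DecidableEq α] {V : Type*} {G : SimpleGraph V}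

theorem card_symmDiff_le_length (φ : G ↪g cubeGraph α) {u v : V} (p : G.Walk u v) :
    (φ u ∆ φ v).card ≤ p.length := by
  induction p with
  | nil => simp
  | @cons u v w h p ih =>
    have h1 : (φ u ∆ φ v).card = 1 := φ.map_adj_iff.2 h
    have h2 := Finset.card_le_card (show φ u ∆ φ w ⊆ (φ u ∆ φ v) ∪ (φ v ∆ φ w) from
      symmDiff_triangle _ _ _)
    have h3 := Finset.card_union_le (φ u ∆ φ v) (φ v ∆ φ w)
    rw [SimpleGraph.Walk.length_cons]
    omega

/-- If one can always move one step closer, the embedding into the cube is isometric. -/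
theorem dist_eq_card_symmDiff (φ : G ↪g cubeGraph α)
    (hstep : ∀ u v, u ≠ v → ∃ a ∈ φ u ∆ φ v, φ u ∆ {a} ∈ Set.range φ) (u v : V) :
    G.dist u v = (φ u ∆ φ v).card := by
  have hw : ∀ (c : ℕ) (u v : V), (φ u ∆ φ v).card = c → ∃ p : G.Walk u v, p.length = c := by
    intro c
    induction c with
    | zero =>
      intro u v h
      have : φ u = φ v := symmDiff_eq_bot.1 (Finset.card_eq_zero.1 h)
      obtain rfl := φ.injective this
      exact ⟨.nil, rfl⟩
    | succ c ih =>
      intro u v h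
      have hne : u ≠ v := by rintro rfl; simp at h
      obtain ⟨a, ha, w, hw⟩ := hstep u v hne
      have hadj : G.Adj u w := φ.map_adj_iff.1 (cubeGraph_adj_iff_exists.2 ⟨a, hw⟩)
      have he : φ w ∆ φ v = (φ u ∆ φ v).erase a := by
        rw [hw]
        ext x
        simp only [Finset.mem_symmDiff, Finset.mem_erase, Finset.mem_singleton] at ha ⊢
        by_cases hx : x = a
        · subst hx; tauto
        · tauto
      obtain ⟨p, hp⟩ := ih w v (by rw [he, Finset.card_erase_of_mem ha, h]; rfl)
      exact ⟨.cons hadj p, by rw [SimpleGraph.Walk.length_cons, hp]⟩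
  obtain ⟨p, hp⟩ := hw _ u v rfl
  refine le_antisymm (hp ▸ SimpleGraph.dist_le p) ?_
  obtain ⟨q, hq⟩ := SimpleGraph.Reachable.exists_walk_length_eq_dist ⟨p⟩
  rw [← hq]
  exact card_symmDiff_le_length φ q

theorem dist_hasse_upperSet {P : Type*} [PartialOrder P] [Fintype P] [DecidableEq P]
    (F G : UpperSet P) :
    (SimpleGraph.hasse (UpperSet P)).dist F G = (upperFinset F ∆ upperFinset G).card := by
  refine dist_eq_card_symmDiff (upperSetEmbedding P) (fun u v huv => ?_) F G
  obtain ⟨p, hp, h⟩ := exists_isUpperSet_symmDiff_singleton (isUpperSet_upperFinset u)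
    (isUpperSet_upperFinset v) (fun e => huv (upperFinset_injective e))
  exact ⟨p, hp, mem_range_upperFinset.2 h⟩

end Isometry

/-! ### Lucas cubes and the bijection of independent sets -/

section Lucas

variable {n : ℕ}

/-- No two cyclically consecutive positions belong to `s`. -/
def CyclicIndep (s : Finset (Fin n)) : Prop :=
  ∀ i ∈ s, ∀ j ∈ s, ¬ ((i : ℕ) + 1 = j ∨ ((i : ℕ) + 1 = n ∧ (j : ℕ) = 0))

theorem cyclicIndep_mono {s t : Finset (Fin n)} (h : CyclicIndep t) (hst : s ⊆ t) :
    CyclicIndep s := fun i hi j hj => h i (hst hi) j (hst hj)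

theorem eq_add_one_mod_iff (i j : Fin n) :
    (j : ℕ) = ((i : ℕ) + 1) % n ↔ ((i : ℕ) + 1 = j ∨ ((i : ℕ) + 1 = n ∧ (j : ℕ) = 0)) := by
  have hi := i.2
  have hj := j.2
  rcases Nat.lt_or_ge ((i : ℕ) + 1) n with h | h
  · rw [Nat.mod_eq_of_lt h]; omega
  · have : (i : ℕ) + 1 = n := by omega
    rw [this, Nat.mod_self]; omega

theorem isLucasString_iff {u : Fin n → Bool} :
    IsLucasString u ↔ CyclicIndep (onesEquiv (Fin n) u) := by
  simp only [IsLucasString, CyclicIndep, mem_onesEquiv, eq_add_one_mod_iff]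
  grind

/-- The Lucas cube as a subgraph of a cube. -/
def lucasEmbedding (n : ℕ) : lucasCube n ↪g cubeGraph (Fin n) :=
  (hypercubeIso n).toEmbedding.comp (SimpleGraph.Embedding.induce _)

theorem lucasEmbedding_apply (u : {u : Fin n → Bool // IsLucasString u}) :
    lucasEmbedding n u = onesEquiv (Fin n) u.1 := rfl

theorem mem_range_lucasEmbedding {s : Finset (Fin n)} :
    s ∈ Set.range (lucasEmbedding n) ↔ CyclicIndep s := by
  constructor
  · rintro ⟨u, rfl⟩
    exact isLucasString_iff.1 u.2
  · intro h
    exact ⟨⟨(onesEquiv (Fin n)).symm s, isLucasString_iff.2 (by simpa using h)⟩, by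
      simp [lucasEmbedding_apply]⟩

/-- Independence passes to subsets, so an interval lies in the Lucas cube as soon as its top does.
-/
theorem inducedCubeCount_lucasCube (n k : ℕ) :
    inducedCubeCount (lucasCube n) k = {p : Finset (Fin n) × Finset (Fin n) |
      p.2 ⊆ p.1 ∧ p.2.card = k ∧ CyclicIndep p.1}.ncard := by
  rw [inducedCubeCount_eq_ncard (lucasEmbedding n)]
  congr 1
  ext ⟨T, S⟩
  simp only [Set.mem_ofPred_eq, mem_range_lucasEmbedding]
  exact and_congr_right fun _ => and_congr_right fun _ =>
    ⟨fun h => h T Finset.sdiff_subset subset_rfl, fun h s _ hs => cyclicIndep_mono h hs⟩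

/-- Delete a superfluous one if there is any; otherwise add a missing one. The new set stays inside
that of u or of v, hence is independent. -/
theorem dist_lucasCube (u v : {u : Fin n → Bool // IsLucasString u}) :
    (lucasCube n).dist u v = (lucasEmbedding n u ∆ lucasEmbedding n v).card := by
  refine dist_eq_card_symmDiff (lucasEmbedding n) (fun u v huv => ?_) u v
  have hu := mem_range_lucasEmbedding.1 ⟨u, rfl⟩
  have hv := mem_range_lucasEmbedding.1 ⟨v, rfl⟩
  simp only [mem_range_lucasEmbedding]
  by_cases h : lucasEmbedding n u ⊆ lucasEmbedding n v
  · obtain ⟨a, ha, ha'⟩ := Finset.exists_of_ssubset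
      (h.ssubset_of_ne fun e => huv ((lucasEmbedding n).injective e))
    refine ⟨a, Finset.mem_symmDiff.2 (Or.inr ⟨ha, ha'⟩), cyclicIndep_mono hv fun x hx => ?_⟩
    simp only [Finset.mem_symmDiff, Finset.mem_singleton] at hx
    rcases hx with hx | hx
    · exact h hx.1
    · exact hx.1 ▸ ha
  · obtain ⟨a, ha, ha'⟩ := Finset.not_subset.1 h
    refine ⟨a, Finset.mem_symmDiff.2 (Or.inl ⟨ha, ha'⟩), cyclicIndep_mono hu fun x hx => ?_⟩
    simp only [Finset.mem_symmDiff, Finset.mem_singleton] at hx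
    rcases hx with hx | hx
    · exact hx.1
    · exact hx.1 ▸ ha

/-- No two positions in `s` are consecutive, nor are they the first and the third. -/
def FenceIndep (s : Finset (Fin n)) : Prop :=
  ∀ i ∈ s, ∀ j ∈ s, ¬ ((i : ℕ) + 1 = j ∨ ((i : ℕ) = 0 ∧ (j : ℕ) = 2))

/-- The cyclic shift of the nonzero positions. -/
noncomputable def shiftPerm (n : ℕ) : Equiv.Perm (Fin n) :=
  Equiv.ofBijective
    (fun i => if h : (i : ℕ) = 0 ∨ n = 1 then i else
      if h' : (i : ℕ) + 1 = n then ⟨1, by omega⟩ else ⟨i + 1, by omega⟩)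
    (Finite.injective_iff_bijective.1 fun i j hij => by
      have hi := i.2
      have hj := j.2
      ext
      have := congrArg Fin.val hij
      split_ifs at this <;> (try dsimp only at this) <;> omega)

theorem val_shiftPerm (i : Fin n) : ((shiftPerm n i : Fin n) : ℕ) =
    if (i : ℕ) = 0 ∨ n = 1 then (i : ℕ) else if (i : ℕ) + 1 = n then 1 else (i : ℕ) + 1 := by
  simp only [shiftPerm, Equiv.ofBijective_apply]
  split_ifs <;> rfl

/-- With 0 present, the cycle forbids 1 and n-1, which the shift sends to the positions the fence
forbids (1 and 2, as far as they exist); the path left on 2, ..., n-2 moves to 3, ..., n-1. -/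
theorem fenceIndep_map_shiftPerm (hn : 2 ≤ n) {s : Finset (Fin n)} {z : Fin n}
    (hz : (z : ℕ) = 0) (hzs : z ∈ s) :
    FenceIndep (s.map (shiftPerm n).toEmbedding) ↔ CyclicIndep s := by
  simp only [FenceIndep, CyclicIndep, Finset.forall_mem_map, Equiv.coe_toEmbedding, val_shiftPerm]
  constructor
  · intro h i hi j hj
    have h1 := h i hi j hj
    have h2 := h z hzs i hi
    have h3 := h z hzs j hj
    have := i.2
    have := j.2
    grind
  · intro h i hi j hj
    have h1 := h i hi j hj
    have h2 := h z hzs i hi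
    have h3 := h z hzs j hj
    have h4 := h i hi z hzs
    have h5 := h j hj z hzs
    have := i.2
    have := j.2
    grind

theorem fenceIndep_iff_cyclicIndep {s : Finset (Fin n)} {z : Fin n}
    (hz : (z : ℕ) = 0) (hzs : z ∉ s) : FenceIndep s ↔ CyclicIndep s := by
  have h0 : ∀ i ∈ s, (i : ℕ) ≠ 0 := fun i hi h => hzs (by rwa [Fin.ext (hz.trans h.symm)])
  refine forall₂_congr fun i hi => forall₂_congr fun j hj => ?_
  have := h0 i hi
  have := h0 j hj
  omega

/-- Shift T and S when 0 ∈ T. Otherwise change nothing: without 0 both conditions only forbid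
consecutive positions. The shift fixes 0, so the two cases do not mix. -/
theorem ncard_cyclicIndep_eq_ncard_fenceIndep (hn : 2 ≤ n) (k : ℕ) :
    {p : Finset (Fin n) × Finset (Fin n) | p.2 ⊆ p.1 ∧ p.2.card = k ∧ CyclicIndep p.1}.ncard =
    {p : Finset (Fin n) × Finset (Fin n) | p.2 ⊆ p.1 ∧ p.2.card = k ∧ FenceIndep p.1}.ncard := by
  let z : Fin n := ⟨0, by omega⟩
  have hσz : shiftPerm n z = z := Fin.ext (by rw [val_shiftPerm]; simp [z])
  have hmem : ∀ s : Finset (Fin n), z ∈ s.map (shiftPerm n).toEmbedding ↔ z ∈ s := fun s => by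
    rw [Finset.mem_map_equiv, (Equiv.symm_apply_eq _).2 hσz.symm]
  refine Set.ncard_congr (fun p _ => if z ∈ p.1 then
    (p.1.map (shiftPerm n).toEmbedding, p.2.map (shiftPerm n).toEmbedding) else p) ?_ ?_ ?_
  · rintro ⟨T, S⟩ ⟨hST, hk, hT⟩
    simp only at hST hk hT ⊢
    split_ifs with h
    · exact ⟨Finset.map_subset_map.2 hST, by simpa using hk,
        (fenceIndep_map_shiftPerm hn rfl h).2 hT⟩
    · exact ⟨hST, hk, (fenceIndep_iff_cyclicIndep (z := z) rfl h).2 hT⟩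
  · rintro ⟨T, S⟩ ⟨T', S'⟩ - - heq
    simp only at heq
    split_ifs at heq with h h' h'
    · simpa using heq
    · rw [Prod.mk.injEq] at heq
      exact absurd (heq.1 ▸ (hmem T).2 h) h'
    · rw [Prod.mk.injEq] at heq
      exact absurd (heq.1 ▸ (hmem T').2 h') h
    · exact heq
  · rintro ⟨T, S⟩ ⟨hST, hk, hT⟩
    simp only at hST hk hT
    by_cases h : z ∈ T
    · obtain ⟨T', rfl⟩ : ∃ T' : Finset (Fin n), T'.map (shiftPerm n).toEmbedding = T :=
        ⟨T.map (shiftPerm n).symm.toEmbedding, by simp [Finset.map_map]⟩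
      obtain ⟨S', rfl⟩ : ∃ S' : Finset (Fin n), S'.map (shiftPerm n).toEmbedding = S :=
        ⟨S.map (shiftPerm n).symm.toEmbedding, by simp [Finset.map_map]⟩
      rw [hmem] at h
      exact ⟨(T', S'), ⟨Finset.map_subset_map.1 hST, by simpa using hk,
        (fenceIndep_map_shiftPerm hn rfl h).1 hT⟩, by simp [h]⟩
    · exact ⟨(T, S), ⟨hST, hk, (fenceIndep_iff_cyclicIndep (z := z) rfl h).1 hT⟩, by simp [h]⟩

end Lucas

/-! ### Comparability in an L-fence -/

section Fence

/-- The three arc directions sum to zero, so two different ones add up to the negative of the third,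
and a and c would share an edge. -/
theorem sub_eq_sub_of_hexArc {a b c : HexCell} (hab : HexArc a b) (hbc : HexArc b c)
    (hac : ¬ HexAdj a c) : c - b = b - a := by
  obtain ⟨a1, a2⟩ := a
  obtain ⟨b1, b2⟩ := b
  obtain ⟨c1, c2⟩ := c
  simp only [HexAdj, HexArc, Prod.mk_sub_mk, Prod.mk.injEq] at *
  omega

theorem not_hexArc_symm {a b : HexCell} (hab : HexArc a b) : ¬ HexArc b a := by
  obtain ⟨a1, a2⟩ := a
  obtain ⟨b1, b2⟩ := b
  simp only [HexArc, Prod.mk_sub_mk, Prod.mk.injEq] at *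
  omega

theorem hexArc_congr {a b c d : HexCell} (h : d - c = b - a) : HexArc c d ↔ HexArc a b := by
  unfold HexArc
  rw [h]

variable {n : ℕ} {h : Fin n → HexCell}

/-- Two arcs in succession force a linear attachment, which occurs only at the first three hexagons.
-/
theorem IsLucasene.ends_of_hexArc (hh : IsLucasene h) {i j k : Fin n}
    (hij : HexArc (h i) (h j)) (hjk : HexArc (h j) (h k)) :
    ((i : ℕ) = 0 ∧ (j : ℕ) = 1 ∧ (k : ℕ) = 2) ∨ ((i : ℕ) = 2 ∧ (j : ℕ) = 1 ∧ (k : ℕ) = 0) := by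
  have h1 := (hh.adj_iff i j).1 (Or.inl hij)
  have h2 := (hh.adj_iff j k).1 (Or.inl hjk)
  have hik : (i : ℕ) ≠ k := fun e => by
    obtain rfl := Fin.ext e
    exact not_hexArc_symm hij hjk
  have hnadj : ¬ HexAdj (h i) (h k) := fun e => by
    have := (hh.adj_iff i k).1 e
    omega
  have hlin := sub_eq_sub_of_hexArc hij hjk hnadj
  by_cases hlt : (i : ℕ) + 1 = j
  · have := (hh.linear_iff i j k hlt (by omega)).1 hlin
    omega
  · have := (hh.linear_iff k j i (by omega) (by omega)).1 (by
      rw [← neg_sub, ← hlin, neg_sub])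
    omega

theorem IsLucasene.hexArc_linear (hh : IsLucasene h) {i j k : Fin n} (hi : (i : ℕ) = 0)
    (hj : (j : ℕ) = 1) (hk : (k : ℕ) = 2) :
    (HexArc (h i) (h j) ∧ HexArc (h j) (h k)) ∨ (HexArc (h k) (h j) ∧ HexArc (h j) (h i)) := by
  have hlin := (hh.linear_iff i j k (by omega) (by omega)).2 hi
  rcases (hh.adj_iff i j).2 (by omega) with ha | ha
  · exact Or.inl ⟨ha, (hexArc_congr hlin).2 ha⟩
  · refine Or.inr ⟨?_, ha⟩
    rw [hexArc_congr (a := h j) (b := h i)]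
    · exact ha
    · rw [← neg_sub, hlin, neg_sub]

variable {Ξ : Type*} [PartialOrder Ξ] {e : Fin n ≃ Ξ}

/-- A chain of covers has at most two steps: the middle of two successive covers is always position
1, so a third cover would put position 0 or 2 in the middle. -/
theorem IsLucasene.of_transGen_covBy (hh : IsLucasene h)
    (he : ∀ i j : Fin n, e j ⋖ e i ↔ HexArc (h i) (h j)) {x y : Ξ}
    (hxy : Relation.TransGen (· ⋖ ·) x y) :
    HexArc (h (e.symm y)) (h (e.symm x)) ∨
      ((e.symm x : ℕ) = 0 ∧ (e.symm y : ℕ) = 2) ∨ ((e.symm x : ℕ) = 2 ∧ (e.symm y : ℕ) = 0) := by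
  have hcov : ∀ {a b}, a ⋖ b ↔ HexArc (h (e.symm b)) (h (e.symm a)) := fun {a b} => by
    rw [← he]; simp
  induction hxy with
  | single hc => exact Or.inl (hcov.1 hc)
  | @tail y z hxy hyz ih =>
    have hlt : ∀ {a b : Ξ}, Relation.TransGen (· ⋖ ·) a b → a < b := fun {a b} hab => by
      induction hab with
      | single hc => exact hc.lt
      | tail _ hc ih => exact ih.trans hc.lt
    have hxy' := hlt hxy
    have hzy := hcov.1 hyz
    rcases ih with hyx | hends
    · have := hh.ends_of_hexArc hzy hyx
      omega
    · exfalso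
      obtain ⟨p, hp⟩ : ∃ p : Fin n, (p : ℕ) = 1 :=
        ⟨⟨1, by have := (e.symm x).2; have := (e.symm y).2; omega⟩, rfl⟩
      have hyx : ¬ (HexArc (h (e.symm x)) (h p) ∧ HexArc (h p) (h (e.symm y))) := fun ⟨h1, h2⟩ => by
        have h1' := (he _ _).2 h1
        have h2' := (he _ _).2 h2
        rw [e.apply_symm_apply] at h1' h2'
        exact lt_asymm hxy' (h2'.lt.trans h1'.lt)
      have hlin : HexArc (h (e.symm y)) (h p) ∧ HexArc (h p) (h (e.symm x)) := by
        rcases hends with ⟨hx, hy⟩ | ⟨hx, hy⟩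
        · exact (hh.hexArc_linear hx hp hy).resolve_left hyx
        · exact (hh.hexArc_linear hy hp hx).resolve_right hyx
      have := hh.ends_of_hexArc hzy hlin.1
      omega

theorem IsLucasene.lt_or_gt_iff (hh : IsLucasene h)
    (he : ∀ i j : Fin n, e j ⋖ e i ↔ HexArc (h i) (h j)) (i j : Fin n) :
    e i < e j ∨ e j < e i ↔ ((i : ℕ) + 1 = j ∨ (j : ℕ) + 1 = i) ∨
      ((i : ℕ) = 0 ∧ (j : ℕ) = 2) ∨ ((i : ℕ) = 2 ∧ (j : ℕ) = 0) := by
  classical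
  let _ : Fintype Ξ := Fintype.ofEquiv _ e
  -- Needed so that `<` is the transitive closure of the covering relation.
  let _ : LocallyFiniteOrder Ξ := Fintype.toLocallyFiniteOrder
  constructor
  · have key : ∀ i j, e i < e j → ((i : ℕ) + 1 = j ∨ (j : ℕ) + 1 = i) ∨
        ((i : ℕ) = 0 ∧ (j : ℕ) = 2) ∨ ((i : ℕ) = 2 ∧ (j : ℕ) = 0) := fun i j hij => by
      have := hh.of_transGen_covBy he (transGen_covBy_of_lt hij)
      simp only [Equiv.symm_apply_apply] at this
      rcases this with h1 | h1
      · have := (hh.adj_iff j i).1 (Or.inl h1)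
        omega
      · omega
    rintro (hij | hij)
    · exact key i j hij
    · have := key j i hij
      omega
  · have key : ∀ i j : Fin n, (i : ℕ) = 0 → (j : ℕ) = 2 → e i < e j ∨ e j < e i :=
      fun i j hi hj => by
        obtain ⟨p, hp⟩ : ∃ p : Fin n, (p : ℕ) = 1 := ⟨⟨1, by have := j.2; omega⟩, rfl⟩
        rcases hh.hexArc_linear hi hp hj with ⟨h1, h2⟩ | ⟨h1, h2⟩
        · exact Or.inr (((he _ _).2 h2).lt.trans ((he _ _).2 h1).lt)
        · exact Or.inl (((he _ _).2 h2).lt.trans ((he _ _).2 h1).lt)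
    rintro (hij | hij | hij)
    · rcases (hh.adj_iff i j).2 hij with h1 | h1
      · exact Or.inr ((he _ _).2 h1).lt
      · exact Or.inl ((he _ _).2 h1).lt
    · exact key i j hij.1 hij.2
    · exact (key j i hij.2 hij.1).symm

theorem IsLucasene.isAntichain_map_iff (hh : IsLucasene h)
    (he : ∀ i j : Fin n, e j ⋖ e i ↔ HexArc (h i) (h j)) (s : Finset (Fin n)) :
    IsAntichain (· ≤ ·) (s.map e.toEmbedding : Set Ξ) ↔ FenceIndep s := by
  constructor
  · intro hs i hi j hj hij
    have hmem : ∀ l ∈ s, e l ∈ (s.map e.toEmbedding : Set Ξ) := fun l hl => by simpa using hl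
    rcases (hh.lt_or_gt_iff he i j).2 (by omega) with hlt | hlt
    · exact hs (hmem i hi) (hmem j hj) hlt.ne hlt.le
    · exact hs (hmem j hj) (hmem i hi) hlt.ne hlt.le
  · intro hs a ha b hb hab hle
    simp only [Finset.coe_map, Equiv.coe_toEmbedding, Set.mem_image, Finset.mem_coe] at ha hb
    obtain ⟨i, hi, rfl⟩ := ha
    obtain ⟨j, hj, rfl⟩ := hb
    have h1 := (hh.lt_or_gt_iff he i j).1 (Or.inl (lt_of_le_of_ne hle hab))
    have h2 := hs i hi j hj
    have h3 := hs j hj i hi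
    omega

theorem inducedCubeCount_lucasCube_eq_hasse {Ξ : Type*} [PartialOrder Ξ] (hn : 2 ≤ n)
    (hΞ : IsLFence n Ξ) (k : ℕ) :
    inducedCubeCount (lucasCube n) k = inducedCubeCount (SimpleGraph.hasse (UpperSet Ξ)) k := by
  classical
  obtain ⟨h, hh, e, he⟩ := hΞ
  let _ : Fintype Ξ := Fintype.ofEquiv _ e
  rw [inducedCubeCount_lucasCube, ncard_cyclicIndep_eq_ncard_fenceIndep hn,
    inducedCubeCount_hasse_upperSet]
  refine Set.ncard_congr (fun p _ => (p.1.map e.toEmbedding, p.2.map e.toEmbedding)) ?_ ?_ ?_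
  · rintro ⟨T, S⟩ ⟨hST, hk, hT⟩
    exact ⟨Finset.map_subset_map.2 hST, by simpa using hk, (hh.isAntichain_map_iff he T).2 hT⟩
  · rintro ⟨T, S⟩ ⟨T', S'⟩ - - heq
    simpa using heq
  · rintro ⟨T, S⟩ ⟨hST, hk, hT⟩
    simp only at hST hk hT
    obtain ⟨T', rfl⟩ : ∃ T' : Finset (Fin n), T'.map e.toEmbedding = T :=
      ⟨T.map e.symm.toEmbedding, by simp [Finset.map_map]⟩
    obtain ⟨S', rfl⟩ : ∃ S' : Finset (Fin n), S'.map e.toEmbedding = S :=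
      ⟨S.map e.symm.toEmbedding, by simp [Finset.map_map]⟩
    exact ⟨(T', S'), ⟨Finset.map_subset_map.1 hST, by simpa using hk,
      (hh.isAntichain_map_iff he T').1 hT⟩, rfl⟩

end Fence

/-! ### Non-isomorphism, and the odd case -/

section NonIsomorphism

variable {n : ℕ}

theorem exists_singleton_lucas (hn : 2 ≤ n) (i : Fin n) :
    ∃ u, lucasEmbedding n u = {i} := by
  refine mem_range_lucasEmbedding.2 fun a ha b hb => ?_
  rw [Finset.mem_singleton] at ha hb
  subst ha hb
  omega

theorem exists_empty_lucas (n : ℕ) : ∃ u, lucasEmbedding n u = ∅ :=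
  mem_range_lucasEmbedding.2 fun a ha => by simp at ha

/-- An upper set of a poset of size `n` containing a chain with three elements has fewer than `n`
neighbours in the Hasse diagram. -/
theorem isEmpty_lucasCube_iso_of_chain {P : Type*} [PartialOrder P] (hn : 2 ≤ n) (e : Fin n ≃ P)
    {a b c : P} (hab : a < b) (hbc : b < c) :
    IsEmpty (lucasCube n ≃g SimpleGraph.hasse (UpperSet P)) := by
  classical
  let _ : Fintype P := Fintype.ofEquiv _ e
  refine ⟨fun f => ?_⟩
  obtain ⟨o, ho⟩ := exists_empty_lucas n
  choose u hu using exists_singleton_lucas hn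
  have hadj : ∀ i, (lucasCube n).Adj o (u i) := fun i =>
    (lucasEmbedding n).map_adj_iff.1 (by rw [ho, hu]; simp [cubeGraph_adj])
  have hex : ∀ i, ∃ p, upperFinset (f (u i)) = upperFinset (f o) ∆ {p} := fun i =>
    cubeGraph_adj_iff_exists.1 ((upperSetEmbedding P).map_adj_iff.2 (f.map_adj_iff.2 (hadj i)))
  choose p hp using hex
  have hinj : Function.Injective p := fun i j hij => by
    have h1 : upperFinset (f (u i)) = upperFinset (f (u j)) := by rw [hp, hp, hij]
    have h2 : u i = u j := f.injective (upperFinset_injective h1)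
    simpa [hu] using congrArg (lucasEmbedding n) h2
  -- The n neighbours of the zero string toggle n different elements of P, hence all of them.
  have hsurj : Function.Surjective p :=
    ((Fintype.bijective_iff_injective_and_card p).2
      ⟨hinj, Fintype.card_congr e⟩).surjective
  have hup : ∀ q, IsUpperSet (↑(upperFinset (f o) ∆ {q}) : Set P) := fun q => by
    obtain ⟨i, rfl⟩ := hsurj q
    rw [← hp]
    exact isUpperSet_upperFinset _
  have hF := isUpperSet_upperFinset (f o)
  -- If b is present, c cannot be removed; if b is absent, a cannot be added.
  by_cases hb : b ∈ upperFinset (f o)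
  · have hc := hF hbc.le hb
    have := hup c hbc.le (Finset.mem_coe.2 (Finset.mem_symmDiff.2
      (Or.inl ⟨hb, by simpa using hbc.ne⟩)))
    simp only [Finset.mem_coe, Finset.mem_symmDiff, Finset.mem_singleton] at this hc
    tauto
  · have ha : a ∉ upperFinset (f o) := fun ha => hb (hF hab.le ha)
    have := hup a hab.le (Finset.mem_coe.2 (Finset.mem_symmDiff.2
      (Or.inr ⟨by simp, ha⟩)))
    simp only [Finset.mem_coe, Finset.mem_symmDiff, Finset.mem_singleton] at this
    rcases this with h | h
    · exact hb h.1
    · exact hab.ne h.1.symm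

theorem IsLFence.exists_chain {Ξ : Type*} [PartialOrder Ξ] (hΞ : IsLFence n Ξ) (hn : 3 ≤ n) :
    ∃ a b c : Ξ, a < b ∧ b < c := by
  obtain ⟨h, hh, e, he⟩ := hΞ
  rcases hh.hexArc_linear (i := ⟨0, by omega⟩) (j := ⟨1, by omega⟩) (k := ⟨2, by omega⟩)
    rfl rfl rfl with ⟨h1, h2⟩ | ⟨h1, h2⟩
  · exact ⟨_, _, _, ((he _ _).2 h2).lt, ((he _ _).2 h1).lt⟩
  · exact ⟨_, _, _, ((he _ _).2 h2).lt, ((he _ _).2 h1).lt⟩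

theorem isEmpty_lucasCube_iso_hasse {Ξ : Type*} [PartialOrder Ξ] (hΞ : IsLFence n Ξ)
    (hn : 3 ≤ n) : IsEmpty (lucasCube n ≃g SimpleGraph.hasse (UpperSet Ξ)) := by
  obtain ⟨a, b, c, hab, hbc⟩ := hΞ.exists_chain hn
  obtain ⟨h, hh, e, he⟩ := hΞ
  exact isEmpty_lucasCube_iso_of_chain (by omega) e hab hbc

/-- Isomorphic lattices have isomorphic Hasse diagrams. -/
def hasseIso {L M : Type*} [Preorder L] [Preorder M] (f : L ≃o M) :
    SimpleGraph.hasse L ≃g SimpleGraph.hasse M where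
  toEquiv := f.toEquiv
  map_rel_iff' {a b} := by
    simp only [SimpleGraph.hasse_adj]
    exact or_congr (apply_covBy_apply_iff f) (apply_covBy_apply_iff f)

/-- Equality in the triangle inequality means that no element is toggled twice, so X agrees with A
and B wherever they agree. -/
theorem subset_of_card_symmDiff_add {α : Type*} [DecidableEq α] {A B X : Finset α}
    (h : (A ∆ X).card + (X ∆ B).card = (A ∆ B).card) : A ∩ B ⊆ X ∧ X ⊆ A ∪ B := by
  have h1 : A ∆ B ⊆ A ∆ X ∪ X ∆ B := symmDiff_triangle _ _ _
  have h2 : A ∆ B = A ∆ X ∪ X ∆ B := Finset.eq_of_subset_of_card_le h1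
    ((Finset.card_union_le _ _).trans h.le)
  have h3 : ∀ x, x ∈ A ∆ X → x ∈ A ∆ B := fun x hx => h2 ▸ Finset.mem_union_left _ hx
  simp only [Finset.mem_symmDiff] at h3
  constructor
  · intro x hx
    rw [Finset.mem_inter] at hx
    by_contra hxX
    have := h3 x (Or.inl ⟨hx.1, hxX⟩)
    tauto
  · intro x hx
    rw [Finset.mem_union]
    by_cases hxA : x ∈ A
    · exact Or.inl hxA
    · have := h3 x (Or.inr ⟨hx, hxA⟩)
      tauto

/-- A Lucas cube of odd length has no two vertices whose interval is everything. -/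
theorem not_exists_antipodes {m : ℕ} (hm : 1 ≤ m)
    (a b : {u : Fin (2 * m + 1) → Bool // IsLucasString u})
    (hab : ∀ x, (lucasCube (2 * m + 1)).dist a x + (lucasCube (2 * m + 1)).dist x b =
      (lucasCube (2 * m + 1)).dist a b) : False := by
  set A := lucasEmbedding _ a with hA
  set B := lucasEmbedding _ b with hB
  have hbet : ∀ x, A ∩ B ⊆ lucasEmbedding _ x ∧ lucasEmbedding _ x ⊆ A ∪ B := fun x => by
    have := hab x
    simp only [dist_lucasCube] at this
    exact subset_of_card_symmDiff_add this
  -- Betweenness of the empty set gives A ∩ B = ∅; betweenness of the singletons makes A ∪ B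
  -- everything.
  have hcompl : ∀ i, i ∈ B ↔ i ∉ A := by
    obtain ⟨o, ho⟩ := exists_empty_lucas (2 * m + 1)
    have h1 := (hbet o).1
    rw [ho, Finset.subset_empty] at h1
    intro i
    obtain ⟨u, hu⟩ := exists_singleton_lucas (n := 2 * m + 1) (by omega) i
    have h2 := (hbet u).2
    rw [hu, Finset.singleton_subset_iff, Finset.mem_union] at h2
    have h3 : i ∉ A ∩ B := by simp [h1]
    rw [Finset.mem_inter] at h3
    tauto
  have hAc : CyclicIndep A := mem_range_lucasEmbedding.1 ⟨a, rfl⟩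
  have hBc : CyclicIndep B := mem_range_lucasEmbedding.1 ⟨b, rfl⟩
  have halt : ∀ i j : Fin (2 * m + 1),
      ((i : ℕ) + 1 = j ∨ ((i : ℕ) + 1 = 2 * m + 1 ∧ (j : ℕ) = 0)) → (j ∈ A ↔ i ∉ A) := by
    intro i j hij
    have h1 := fun hi hj => hAc i hi j hj hij
    have h2 := fun hi hj => hBc i hi j hj hij
    rw [hcompl, hcompl] at h2
    tauto
  have hpar : ∀ (l : ℕ) (hl : l < 2 * m + 1),
      ((⟨l, hl⟩ : Fin (2 * m + 1)) ∈ A ↔ (Even l ↔ (0 : Fin (2 * m + 1)) ∈ A)) := by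
    intro l
    induction l with
    | zero => intro hl; simp
    | succ l ih =>
      intro hl
      rw [halt ⟨l, by omega⟩ ⟨l + 1, hl⟩ (Or.inl rfl), ih, Nat.even_add_one]
      tauto
  -- By parity, positions 0 and 2m agree, yet they are cyclically consecutive and must differ.
  have h1 := hpar (2 * m) (by omega)
  have h2 := halt ⟨2 * m, by omega⟩ 0 (Or.inr ⟨rfl, rfl⟩)
  have h3 : Even (2 * m) := even_two_mul m
  tauto

theorem dist_map_iso {V W : Type*} {G : SimpleGraph V} {H : SimpleGraph W} (f : G ≃g H)
    (u v : V) : H.dist (f u) (f v) = G.dist u v := by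
  rw [SimpleGraph.dist_eq_sInf, SimpleGraph.dist_eq_sInf]
  congr 1
  ext c
  constructor
  · rintro ⟨p, rfl⟩
    exact ⟨(p.map f.symm.toHom).copy (f.symm_apply_apply u) (f.symm_apply_apply v), by simp⟩
  · rintro ⟨p, rfl⟩
    exact ⟨p.map f.toHom, by simp⟩

theorem isEmpty_hasse_iso_lucasCube_odd {m : ℕ} (hm : 1 ≤ m) (L : Type*) [DistribLattice L]
    [Finite L] : IsEmpty (SimpleGraph.hasse L ≃g lucasCube (2 * m + 1)) := by
  classical
  refine ⟨fun f => ?_⟩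
  let _ : Fintype L := Fintype.ofFinite L
  obtain ⟨o, -⟩ := exists_empty_lucas (2 * m + 1)
  have : Nonempty L := ⟨f.symm o⟩
  let _ : OrderBot L := Fintype.toOrderBot L
  -- Birkhoff's representation, with lower sets replaced by their complements.
  let g : L ≃o UpperSet {a : L // SupIrred a} :=
    OrderIso.lowerSetSupIrred.trans upperSetIsoLowerSet.symm
  let F := (hasseIso g).symm.trans f
  refine not_exists_antipodes hm (F ⊤) (F ⊥) fun x => ?_
  obtain ⟨y, rfl⟩ := F.surjective x
  simp only [dist_map_iso, dist_hasse_upperSet]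
  have h1 : upperFinset (⊤ : UpperSet {a : L // SupIrred a}) = ∅ := by
    ext; simp
  have h2 : upperFinset (⊥ : UpperSet {a : L // SupIrred a}) = Finset.univ := by
    ext; simp
  rw [h1, h2]
  have h3 : upperFinset y ∆ Finset.univ = (upperFinset y)ᶜ := symmDiff_top _
  rw [Finset.empty_symmDiff, Finset.empty_symmDiff, h3, Finset.card_add_card_compl,
    Finset.card_univ]

end NonIsomorphism

/-! ### Crowns and the even case -/

section Crown

/-- The crown with `2 * m` elements: even elements are minimal, odd elements are maximal, and
cyclically consecutive elements are comparable. -/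
structure Crown (m : ℕ) where
  /-- The position of an element on the cycle. -/
  pos : Fin (2 * m)

variable {m : ℕ}

/-- Cyclically consecutive positions. -/
def CyclicSucc {n : ℕ} (i j : Fin n) : Prop :=
  (i : ℕ) + 1 = j ∨ ((i : ℕ) + 1 = n ∧ (j : ℕ) = 0)

instance : PartialOrder (Crown m) where
  le a b := a = b ∨ (Even (a.pos : ℕ) ∧ ¬ Even (b.pos : ℕ) ∧
    (CyclicSucc a.pos b.pos ∨ CyclicSucc b.pos a.pos))
  le_refl a := Or.inl rfl
  le_trans a b c := by
    rintro (rfl | h1) (rfl | h2)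
    · exact Or.inl rfl
    · exact Or.inr h2
    · exact Or.inr h1
    · exact absurd h2.1 h1.2.1
  le_antisymm a b := by
    rintro (rfl | h1) (h2 | h2)
    · rfl
    · rfl
    · exact h2.symm
    · exact absurd h2.1 h1.2.1

theorem Crown.le_def {a b : Crown m} : a ≤ b ↔ a = b ∨ (Even (a.pos : ℕ) ∧ ¬ Even (b.pos : ℕ) ∧
    (CyclicSucc a.pos b.pos ∨ CyclicSucc b.pos a.pos)) := Iff.rfl

/-- The elements of the crown are the positions. -/
def crownEquiv (m : ℕ) : Fin (2 * m) ≃ Crown m := ⟨Crown.mk, Crown.pos, fun _ => rfl, fun _ => rfl⟩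

instance : Fintype (Crown m) := Fintype.ofEquiv _ (crownEquiv m)

instance : DecidableEq (Crown m) := (crownEquiv m).symm.decidableEq

/-- The even length enters here: parity alternates also across the wrap-around. -/
theorem CyclicSucc.even_iff {i j : Fin (2 * m)} (h : CyclicSucc i j) :
    Even (i : ℕ) ↔ ¬ Even (j : ℕ) := by
  rcases h with h | h
  · rw [← h, Nat.even_add_one, not_not]
  · have : Even ((i : ℕ) + 1) := by rw [h.1]; exact even_two_mul m
    rw [h.2]
    rw [Nat.even_add_one] at this
    simpa using this

/-- Complementing a set at the odd positions turns independent sets of the cycle into upper sets of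
the crown. -/
def crownSet (s : Finset (Fin (2 * m))) : Finset (Crown m) :=
  Finset.univ.filter fun a => a.pos ∈ s ↔ Even (a.pos : ℕ)

theorem mem_crownSet {s : Finset (Fin (2 * m))} {a : Crown m} :
    a ∈ crownSet s ↔ (a.pos ∈ s ↔ Even (a.pos : ℕ)) := by simp [crownSet]

theorem card_symmDiff_crownSet (s t : Finset (Fin (2 * m))) :
    (crownSet s ∆ crownSet t).card = (s ∆ t).card := by
  have : crownSet s ∆ crownSet t = (s ∆ t).map (crownEquiv m).toEmbedding := by
    ext a
    rw [Finset.mem_map_equiv]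
    change _ ↔ a.pos ∈ s ∆ t
    simp only [Finset.mem_symmDiff, mem_crownSet]
    tauto
  rw [this, Finset.card_map]

theorem isUpperSet_crownSet_iff {s : Finset (Fin (2 * m))} :
    IsUpperSet (crownSet s : Set (Crown m)) ↔ CyclicIndep s := by
  have key : ∀ a b : Crown m, Even (a.pos : ℕ) → ¬ Even (b.pos : ℕ) →
      ((a ∈ crownSet s → b ∈ crownSet s) ↔ ¬ (a.pos ∈ s ∧ b.pos ∈ s)) := by
    intro a b ha hb
    rw [mem_crownSet, mem_crownSet]
    tauto
  constructor
  · intro h i hi j hj (hij : CyclicSucc i j)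
    have hev := hij.even_iff
    by_cases hie : Even (i : ℕ)
    · exact (key ⟨i⟩ ⟨j⟩ hie (hev.1 hie)).1 (fun ha => h (show Crown.mk i ≤ Crown.mk j from
        Or.inr ⟨hie, hev.1 hie, Or.inl hij⟩) ha) ⟨hi, hj⟩
    · have hje : Even (j : ℕ) := by tauto
      exact (key ⟨j⟩ ⟨i⟩ hje hie).1 (fun ha => h (show Crown.mk j ≤ Crown.mk i from
        Or.inr ⟨hje, hie, Or.inr hij⟩) ha) ⟨hj, hi⟩
  · intro h a b hab ha
    rcases Crown.le_def.1 hab with rfl | ⟨hae, hbo, hs⟩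
    · exact ha
    · refine (key a b hae hbo).2 (fun ⟨h1, h2⟩ => ?_) ha
      rcases hs with hs | hs
      · exact h _ h1 _ h2 hs
      · exact h _ h2 _ h1 hs

/-- The Lucas cube of even length is the Hasse diagram of the lattice of upper sets of a crown. -/
theorem nonempty_hasse_crown_iso_lucasCube (m : ℕ) :
    Nonempty (SimpleGraph.hasse (UpperSet (Crown m)) ≃g lucasCube (2 * m)) := by
  classical
  have hex : ∀ u : {u : Fin (2 * m) → Bool // IsLucasString u}, ∃ F : UpperSet (Crown m),
      upperFinset F = crownSet (lucasEmbedding (2 * m) u) := fun u =>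
    mem_range_upperFinset.2 (isUpperSet_crownSet_iff.2 (mem_range_lucasEmbedding.1 ⟨u, rfl⟩))
  choose F hF using hex
  have hinj : Function.Injective (crownSet (m := m)) := fun s t h => by
    have := card_symmDiff_crownSet s t
    rw [h, symmDiff_self] at this
    exact symmDiff_eq_bot.1 (Finset.card_eq_zero.1 this.symm)
  refine ⟨SimpleGraph.Iso.symm ⟨Equiv.ofBijective F ⟨fun u v h => ?_, fun G => ?_⟩, ?_⟩⟩
  · exact (lucasEmbedding _).injective (hinj (by rw [← hF, ← hF, h]))
  -- Complementing at the odd positions is its own inverse.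
  · let s : Finset (Fin (2 * m)) := Finset.univ.filter fun i => Crown.mk i ∈ G ↔ Even (i : ℕ)
    have hs : crownSet s = upperFinset G := by
      ext a
      simp only [mem_crownSet, s, Finset.mem_filter, Finset.mem_univ, true_and, mem_upperFinset]
      change ((a ∈ G ↔ _) ↔ _) ↔ _
      tauto
    obtain ⟨u, hu⟩ := mem_range_lucasEmbedding.2
      (isUpperSet_crownSet_iff.1 (hs ▸ isUpperSet_upperFinset G))
    exact ⟨u, upperFinset_injective (by rw [hF, hu, hs])⟩
  · intro u v
    rw [← (upperSetEmbedding (Crown m)).map_adj_iff, ← (lucasEmbedding (2 * m)).map_adj_iff,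
      cubeGraph_adj, cubeGraph_adj, ← card_symmDiff_crownSet, ← hF, ← hF]
    rfl

end Crown

/-! ### The theorem -/

theorem mainTheorem12 (n : ℕ) (hn : 2 ≤ n) {Ξ : Type*} [PartialOrder Ξ] (hΞ : IsLFence n Ξ) :
    -- `Λ_n` and `Ω_n` have the same number of induced cubes of every dimension
    (∀ k : ℕ, inducedCubeCount (lucasCube n) k =
      inducedCubeCount (SimpleGraph.hasse (MatchableLucasLattice Ξ)) k) ∧
    -- but they are different graphs
    (3 ≤ n → IsEmpty (lucasCube n ≃g SimpleGraph.hasse (MatchableLucasLattice Ξ))) ∧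
    -- even case
    (∀ m : ℕ, 1 ≤ m → n = 2 * m →
      ∃ (L : Type) (_ : DistribLattice L), Finite L ∧
        Nonempty (SimpleGraph.hasse L ≃g lucasCube n) ∧
        (2 ≤ m → IsEmpty (L ≃o MatchableLucasLattice Ξ))) ∧
    -- odd case
    (∀ m : ℕ, 1 ≤ m → n = 2 * m + 1 →
      ∀ (L : Type*) [DistribLattice L] [Finite L],
        IsEmpty (SimpleGraph.hasse L ≃g lucasCube n)) := by
  refine ⟨inducedCubeCount_lucasCube_eq_hasse hn hΞ, isEmpty_lucasCube_iso_hasse hΞ, ?_, ?_⟩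
  · rintro m - rfl
    obtain ⟨f⟩ := nonempty_hasse_crown_iso_lucasCube m
    refine ⟨UpperSet (Crown m), inferInstance,
      Finite.of_injective _ (upperFinset_injective (P := Crown m)), ⟨f⟩, fun hm => ⟨fun g => ?_⟩⟩
    -- A lattice isomorphism would make the graphs Λ_n and Ω_n isomorphic, although n = 2m ≥ 4.
    exact (isEmpty_lucasCube_iso_hasse hΞ (by omega)).false (f.symm.trans (hasseIso g))
  · rintro m hm rfl L _ _
    exact isEmpty_hasse_iso_lucasCube_odd hm L
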